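/- Fix $n\ge 0$ and write $[n]=\{1,\dots,n\}$. For a matroid $M$ on $[n]$ let $P_M=\operatorname{conv}\{e_B : B \text{ a basis of } M\}\subseteq\mathbb R^n$ be its matroid polytope, where $e_B$ is the zero-one indicator vector of $B$, and let $\mathbf 1(P_M):\mathbb R^n\to\mathbb Z$ be the indicator function of $P_M$. A function $f$ from the matroids on $[n]$ to an abelian group is a matroid valuation if, whenever $M_1,\dots,M_k$ are matroids on $[n]$ and $c_1,\dots,c_k$ are integers with $\sum_{i=1}^k c_i\,\mathbf 1(P_{M_i})=0$, also $\sum_{i=1}^k c_i f(M_i)=0$. A cyclic flat of $M$ is a flat $F$ of $M$ such that $[n]\setminus F$ is a flat of the dual matroid $M^*$. Let $\mathcal{CF}(M)$ be the lattice of cyclic flats of $M$, ordered by inclusion, let $\mu$ be its Möbius function, and let $\operatorname{cork}_M(F)=\operatorname{rk}_M([n])-\operatorname{rk}_M(F)$. For $F\in\mathcal{CF}(M)$ put $$\tau_M(F)=\sum_{F'\in\mathcal{CF}(M),\ F\subseteq F'}\mu(F,F')\operatorname{cork}_M(F'),$$ and put $\tau_M(F)=0$ for sets $F\subseteq[n]$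 that are not cyclic flats of $M$ (so $\tau_M(\emptyset)=0$ if $M$ has loops). Then the following hold. 1. Let $X_0\subseteq\cdots\subseteq X_k$ be a chain of subsets of $[n]$, and let $r_0\le\cdots\le r_k$ be nonnegative integers ($k\ge 0$). Let $c_{X,r}(M)=1$ if each $X_i$ is a cyclic flat of $M$ with $\operatorname{rk}_M(X_i)=r_i$, and $c_{X,r}(M)=0$ otherwise. Then $c_{X,r}$ is a matroid valuation. 2. The function $M\mapsto\tau_M(\emptyset)$ is a matroid valuation. -/

import Mathlib

namespace Matroid

variable {α : Type*}

/-- `F` is a cyclic flat of `M`: a flat of `M` whose complement is a flat of the dual matroid. -/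
def IsCyclicFlat (M : Matroid α) (F : Set α) : Prop :=
  M.IsFlat F ∧ M✶.IsFlat (M.E \ F)

/-- The set of cyclic flats of `M`, ordered by inclusion. -/
abbrev CyclicFlat (M : Matroid α) : Type _ := {F : Set α // M.IsCyclicFlat F}

noncomputable instance CyclicFlat.instFintype [Finite α] (M : Matroid α) : Fintype M.CyclicFlat :=
  Fintype.ofFinite _

open Classical in
noncomputable instance CyclicFlat.instLocallyFiniteOrder [Finite α] (M : Matroid α) :
    LocallyFiniteOrder M.CyclicFlat :=
  Fintype.toLocallyFiniteOrder

/-- The rank of a set in a matroid on a finite set, as a natural number. -/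
noncomputable def natRk (M : Matroid α) (X : Set α) : ℕ := (M.eRk X).toNat

/-- The corank `d - rk(X)` of a set, where `d` is the rank of the matroid. -/
noncomputable def corank (M : Matroid α) (X : Set α) : ℤ := (M.natRk M.E : ℤ) - (M.natRk X : ℤ)

open Classical in
/-- `τ_M(F) = ∑ μ(F, G) cork(G)` over the cyclic flats `G` containing the cyclic flat `F`, where `μ`
is the Möbius function of the poset of cyclic flats of `M`; it is zero at sets `F` that are not
cyclic flats. -/
noncomputable def tau [Finite α] (M : Matroid α) (F : Set α) : ℤ :=
  if hF : M.IsCyclicFlat F then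
    ∑ G : M.CyclicFlat with ⟨F, hF⟩ ≤ G, IncidenceAlgebra.mu ℤ ⟨F, hF⟩ G * M.corank G
  else 0

/-- The matroid polytope: the convex hull of the zero-one indicator vectors of the bases. -/
def polytope (M : Matroid α) : Set (α → ℝ) :=
  convexHull ℝ {x | ∃ B, M.IsBase B ∧ x = B.indicator 1}

/-- A function of matroids with ground set `α` is a valuation if it satisfies every integer linear
relation satisfied by the indicator functions of the matroid polytopes. -/
def IsValuation {G : Type*} [AddCommGroup G] (f : Matroid α → G) : Prop :=
  ∀ (k : ℕ) (M : Fin k → Matroid α) (c : Fin k → ℤ), (∀ i, (M i).E = Set.univ) →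
    (∑ i, c i • (M i).polytope.indicator (1 : (α → ℝ) → ℤ) = 0) → ∑ i, c i • f (M i) = 0

open Classical in
/-- The matroid function with value `1` on `M` if every `X i` is a cyclic flat of `M` of rank `r i`,
and value `0` otherwise. -/
noncomputable def cyclicFlatIndicator {k : ℕ} (X : Fin k → Set α) (r : Fin k → ℕ)
    (M : Matroid α) : ℤ :=
  if ∀ i, M.IsCyclicFlat (X i) ∧ M.natRk (X i) = r i then 1 else 0

end Matroid

/-! The idea is to express the conditions on `M` as nonemptiness of a compact convex set built from
`P_M` alone. Euler characteristic makes "nonempty" additive: a relation among indicators of compact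
convex sets survives intersection with a fixed closed convex set (`sum_inter_nonempty_eq_zero`) and
passage to the face maximizing a fixed linear form (`sum_mem_toExposed_eq_zero`).

For a chain `𝒞`, the form `chainForm 𝒞` cuts out the face whose vertices are the bases meeting every
member of `𝒞` in a basis of that member. On this face each coordinate sum over a member of `𝒞` is
constantly its rank. The members are all cyclic flats exactly when no coordinate `e` missed by some
member is identically 0 on the face and no coordinate lying in some member is identically 1
(`forall_isCyclicFlat_iff`). Replacing these strict conditions by a uniform margin gives the closed
convex `cyclicRegion`, and part 1 follows.

For part 2, unfolding the recursion for `μ(∅, F)` expresses it through chains of cyclic flats, and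
splitting by the finitely many possible ranks makes the corank a constant coefficient. -/

/-! ### Euler characteristic and relations among compact convex sets -/

open Classical Filter Topology in
/-- One-dimensional case of the Euler characteristic: an integer relation among indicator functions
of compact intervals is a relation among their Euler characteristics. -/
theorem sum_nonempty_eq_zero_of_real {ι : Type*} [Fintype ι] (c : ι → ℤ) (J : ι → Set ℝ)
    (hJ : ∀ i, IsCompact (J i)) (hJc : ∀ i, Convex ℝ (J i))
    (h : ∀ t, ∑ i, (if t ∈ J i then c i else 0) = 0) :
    ∑ i, (if (J i).Nonempty then c i else 0) = 0 := by
  set b : ι → ℝ := fun i => sSup (J i)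
  have hb : ∀ i, (J i).Nonempty → b i ∈ J i := fun i hi => (hJ i).sSup_mem hi
  have hle : ∀ i t, t ∈ J i → t ≤ b i := fun i t ht => le_csSup (hJ i).bddAbove ht
  -- A point `t` just to the right of `s` lies in exactly those intervals that contain `s` and do
  -- not end there. Subtracting the relations at `s` and `t` isolates the intervals with right
  -- endpoint `s`; each nonempty interval has exactly one such endpoint.
  have key : ∀ s : ℝ, ∃ t, ∀ i, t ∈ J i ↔ s ∈ J i ∧ b i ≠ s := by
    intro s
    have : ∀ᶠ t in 𝓝[>] s, ∀ i, t ∈ J i ↔ s ∈ J i ∧ b i ≠ s := by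
      rw [eventually_all]
      intro i
      by_cases hs : s ∈ J i
      · by_cases hbs : b i = s
        · filter_upwards [self_mem_nhdsWithin] with t ht
          have : t ∉ J i := fun h' => absurd (hle i t h') (by rw [hbs]; exact not_le.2 ht)
          simp [this, hbs]
        · have hlt : s < b i := lt_of_le_of_ne (hle i s hs) (Ne.symm hbs)
          filter_upwards [Ioo_mem_nhdsGT hlt] with t ht
          have : t ∈ J i := (hJc i).ordConnected.out hs (hb i ⟨s, hs⟩) ⟨ht.1.le, ht.2.le⟩
          simp [this, hs, hbs]
      · have : (J i)ᶜ ∈ 𝓝[>] s :=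
          mem_nhdsWithin_of_mem_nhds ((hJ i).isClosed.isOpen_compl.mem_nhds hs)
        filter_upwards [this] with t ht
        have ht' : t ∉ J i := ht
        simp [ht', hs]
    exact this.exists
  have key2 : ∀ s : ℝ, ∑ i, (if s ∈ J i ∧ b i = s then c i else 0) = 0 := by
    intro s
    obtain ⟨t, ht⟩ := key s
    have hi : ∀ i, (if s ∈ J i ∧ b i = s then c i else 0)
        = (if s ∈ J i then c i else 0) - (if t ∈ J i then c i else 0) := by
      intro i
      rw [if_congr (ht i) rfl rfl]
      by_cases h3 : s ∈ J i <;> by_cases h4 : b i = s <;> simp [h3, h4]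
    rw [Finset.sum_congr rfl fun i _ => hi i, Finset.sum_sub_distrib, h, h, sub_zero]
  calc ∑ i, (if (J i).Nonempty then c i else 0)
      = ∑ i, ∑ s ∈ Finset.univ.image b, (if s ∈ J i ∧ b i = s then c i else 0) := by
        refine Finset.sum_congr rfl fun i _ => ?_
        rw [Finset.sum_eq_single (b i)]
        · by_cases hi : (J i).Nonempty
          · simp [hi, hb i hi]
          · simp [Set.not_nonempty_iff_eq_empty.1 hi]
        · intro s _ hs
          simp [Ne.symm hs]
        · intro hn
          exact absurd (Finset.mem_image_of_mem b (Finset.mem_univ i)) hn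
    _ = 0 := by
        rw [Finset.sum_comm]
        exact Finset.sum_eq_zero fun s _ => key2 s

open Classical in
/-- An integer relation among indicator functions of compact convex sets is a relation among their
Euler characteristics. -/
theorem sum_nonempty_eq_zero {ι α : Type*} [Fintype ι] [Fintype α] (c : ι → ℤ)
    (K : ι → Set (α → ℝ)) (hK : ∀ i, IsCompact (K i)) (hKc : ∀ i, Convex ℝ (K i))
    (h : ∀ x, ∑ i, (if x ∈ K i then c i else 0) = 0) :
    ∑ i, (if (K i).Nonempty then c i else 0) = 0 := by
  -- The coordinates in `T` are projected away one at a time. Each fibre of a single projection is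
  -- handled by the one-dimensional case, applied to the shadows on the new coordinate axis.
  have main : ∀ T : Finset α, ∀ x : α → ℝ,
      ∑ i, (if ∃ y ∈ K i, ∀ a ∉ T, y a = x a then c i else 0) = 0 := by
    intro T
    induction T using Finset.induction_on with
    | empty =>
      intro x
      refine Eq.trans ?_ (h x)
      refine Finset.sum_congr rfl fun i _ => if_congr ?_ rfl rfl
      constructor
      · rintro ⟨y, hy, hyx⟩
        rwa [← funext fun a => hyx a (by simp)]
      · exact fun hx => ⟨x, hx, fun _ _ => rfl⟩
    | insert a T ha ih =>
      intro x
      set S : Set (α → ℝ) := {y | ∀ b ∉ insert a T, y b = x b}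
      have hS : IsClosed S := by
        simp only [S, Set.ofPred_forall]
        exact isClosed_iInter fun b => isClosed_iInter fun _ =>
          isClosed_eq (continuous_apply b) continuous_const
      have hSc : Convex ℝ S := by
        intro y hy z hz s t _ _ hst b hb
        simp only [Pi.add_apply, Pi.smul_apply, smul_eq_mul]
        rw [hy b hb, hz b hb, ← add_mul, hst, one_mul]
      have := sum_nonempty_eq_zero_of_real c (fun i => (fun y : α → ℝ => y a) '' (K i ∩ S))
        (fun i => ((hK i).inter_right hS).image (continuous_apply a))
        (fun i => ((hKc i).inter hSc).linear_image (LinearMap.proj a : (α → ℝ) →ₗ[ℝ] ℝ))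
        (by
          intro t
          refine Eq.trans ?_ (ih (Function.update x a t))
          refine Finset.sum_congr rfl fun i _ => if_congr ?_ rfl rfl
          constructor
          · rintro ⟨y, ⟨hy, hyS⟩, rfl⟩
            refine ⟨y, hy, fun b hb => ?_⟩
            by_cases hba : b = a
            · subst hba; simp
            · rw [Function.update_of_ne hba]
              exact hyS b (by simp [hba, hb])
          · rintro ⟨y, hy, hyx⟩
            refine ⟨y, ⟨hy, fun b hb => ?_⟩, by simpa using hyx a ha⟩
            simp only [Finset.mem_insert, not_or] at hb
            rw [hyx b hb.2, Function.update_of_ne hb.1])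
      refine Eq.trans ?_ this
      refine Finset.sum_congr rfl fun i _ => if_congr ?_ rfl rfl
      rw [Set.image_nonempty]
      rfl
  refine Eq.trans ?_ (main Finset.univ 0)
  refine Finset.sum_congr rfl fun i _ => if_congr ?_ rfl rfl
  simp [Set.Nonempty]

open Classical in
theorem sum_inter_nonempty_eq_zero {ι α : Type*} [Fintype ι] [Fintype α] (c : ι → ℤ)
    (K : ι → Set (α → ℝ)) (hK : ∀ i, IsCompact (K i)) (hKc : ∀ i, Convex ℝ (K i))
    (h : ∀ x, ∑ i, (if x ∈ K i then c i else 0) = 0) {C : Set (α → ℝ)} (hC : IsClosed C)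
    (hCc : Convex ℝ C) : ∑ i, (if (K i ∩ C).Nonempty then c i else 0) = 0 := by
  refine sum_nonempty_eq_zero c _ (fun i => (hK i).inter_right hC) (fun i => (hKc i).inter hCc) ?_
  intro x
  by_cases hx : x ∈ C
  · simpa [hx] using h x
  · simp [hx]

open Classical Filter Topology in
/-- Passing to the face on which a linear form is maximal preserves integer relations among
indicator functions of compact convex sets. -/
theorem sum_mem_toExposed_eq_zero {ι α : Type*} [Fintype ι] [Fintype α] (c : ι → ℤ)
    (K : ι → Set (α → ℝ)) (hK : ∀ i, IsCompact (K i)) (hKc : ∀ i, Convex ℝ (K i))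
    (h : ∀ x, ∑ i, (if x ∈ K i then c i else 0) = 0) (w : (α → ℝ) →L[ℝ] ℝ) (p : α → ℝ) :
    ∑ i, (if p ∈ w.toExposed (K i) then c i else 0) = 0 := by
  -- The ball is small enough to miss every `K i` not containing `p`. If `p ∈ K i` is not a
  -- maximizer, convexity moves it slightly towards a better point, staying in the ball and gaining
  -- at least `η`. Both constants serve all `i` at once, so one convex test set, the ball cut by `w
  -- p + η ≤ w x`, detects failure of maximality.
  obtain ⟨ε, hε, hε'⟩ : ∃ ε > 0, ∀ i, p ∉ K i → Disjoint (K i) (Metric.closedBall p ε) := by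
    have : ∀ᶠ ε in 𝓝[>] (0 : ℝ), ∀ i, p ∉ K i → Disjoint (K i) (Metric.closedBall p ε) := by
      rw [eventually_all]
      intro i
      by_cases hp : p ∈ K i
      · simp [hp]
      · obtain ⟨r, hr, hr'⟩ := Metric.isOpen_iff.1 (hK i).isClosed.isOpen_compl p hp
        filter_upwards [Ioo_mem_nhdsGT hr] with ε hε _
        rw [Set.disjoint_left]
        intro x hx hx'
        exact hr' (Metric.closedBall_subset_ball hε.2 hx') hx
    obtain ⟨ε, h1, h2⟩ := (this.and self_mem_nhdsWithin).exists
    exact ⟨ε, h2, h1⟩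
  obtain ⟨η, hη, hη'⟩ : ∃ η > 0, ∀ i, p ∈ K i → p ∉ w.toExposed (K i) →
      ∃ x ∈ K i, x ∈ Metric.closedBall p ε ∧ w p + η ≤ w x := by
    have : ∀ᶠ η in 𝓝[>] (0 : ℝ), ∀ i, p ∈ K i → p ∉ w.toExposed (K i) →
        ∃ x ∈ K i, x ∈ Metric.closedBall p ε ∧ w p + η ≤ w x := by
      rw [eventually_all]
      intro i
      by_cases hp : p ∈ K i
      swap
      · simp [hp]
      by_cases hp' : p ∈ w.toExposed (K i)
      · simp [hp']
      obtain ⟨q, hq, hpq⟩ : ∃ q ∈ K i, w p < w q := by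
        by_contra! hcon
        exact hp' ⟨hp, hcon⟩
      have hcont : Continuous fun t : ℝ => p + t • (q - p) := by fun_prop
      have hball : ∀ᶠ t in 𝓝[>] (0 : ℝ), p + t • (q - p) ∈ Metric.closedBall p ε := by
        have := hcont.continuousAt (x := 0)
        refine mem_nhdsWithin_of_mem_nhds (this.preimage_mem_nhds ?_)
        simpa using Metric.closedBall_mem_nhds p hε
      obtain ⟨t, ht, ht0, ht1⟩ := (hball.and (Ioo_mem_nhdsGT (zero_lt_one' ℝ))).exists
      have hpos : 0 < t * (w q - w p) := mul_pos ht0 (sub_pos.2 hpq)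
      filter_upwards [Ioo_mem_nhdsGT hpos] with η hη _ _
      refine ⟨_, (hKc i).add_smul_sub_mem hp hq ⟨ht0.le, ht1.le⟩, ht, ?_⟩
      simp only [map_add, map_smul, map_sub, smul_eq_mul]
      linarith [hη.2]
    obtain ⟨η, h1, h2⟩ := (this.and self_mem_nhdsWithin).exists
    exact ⟨η, h2, h1⟩
  have hC := sum_inter_nonempty_eq_zero c K hK hKc h
    (C := Metric.closedBall p ε ∩ {x | w p + η ≤ w x})
    (Metric.isClosed_closedBall.inter (isClosed_le continuous_const w.continuous))
    ((convex_closedBall p ε).inter (convex_halfSpace_ge w.isLinear _))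
  have hi : ∀ i, (if p ∈ w.toExposed (K i) then c i else 0) = (if p ∈ K i then c i else 0)
      - (if (K i ∩ (Metric.closedBall p ε ∩ {x | w p + η ≤ w x})).Nonempty then c i else 0) := by
    intro i
    by_cases hp : p ∈ K i
    · by_cases hp' : p ∈ w.toExposed (K i)
      · have : ¬ (K i ∩ (Metric.closedBall p ε ∩ {x | w p + η ≤ w x})).Nonempty := by
          rintro ⟨x, hx, _, hx'⟩
          have := hp'.2 x hx
          have hx'' : w p + η ≤ w x := hx'
          linarith
        simp [hp, hp', this]
      · obtain ⟨x, hx, hxb, hxw⟩ := hη' i hp hp'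
        have : (K i ∩ (Metric.closedBall p ε ∩ {x | w p + η ≤ w x})).Nonempty :=
          ⟨x, hx, hxb, hxw⟩
        simp [hp, hp', this]
    · have hp' : p ∉ w.toExposed (K i) := fun h' => hp h'.1
      have : ¬ (K i ∩ (Metric.closedBall p ε ∩ {x | w p + η ≤ w x})).Nonempty := by
        rintro ⟨x, hx, hxb, _⟩
        exact Set.disjoint_left.1 (hε' i hp) hx hxb
      simp [hp, hp', this]
  rw [Finset.sum_congr rfl fun i _ => hi i, Finset.sum_sub_distrib, h, hC, sub_zero]
namespace Matroid

/-! ### Bases adapted to a chain, and cyclic flats -/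

section FaceBases

variable {α : Type*} {M : Matroid α} {𝒞 : Finset (Set α)} {B : Set α}

/-- The bases of `M` that contain a basis of every member of `𝒞`. -/
def faceBases (M : Matroid α) (𝒞 : Finset (Set α)) : Set (Set α) :=
  {B | M.IsBase B ∧ ∀ Z ∈ 𝒞, M.IsBasis (B ∩ Z) Z}

/-- Greedy extension along the chain: extend `I` to a basis `J` of the smallest member, then
continue with `J` and the remaining members. Any base containing `J` meets that smallest member in
exactly `J`, by maximality. -/
theorem exists_mem_faceBases_of_indep (hM : M.E = Set.univ) (h𝒞 : IsChain (· ⊆ ·) (𝒞 : Set (Set α))) :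
    ∀ I, M.Indep I → (∀ Z ∈ 𝒞, I ⊆ Z) → ∃ B ∈ M.faceBases 𝒞, I ⊆ B := by
  classical
  induction 𝒞 using Finset.strongInduction with
  | H 𝒞 ih =>
    intro I hI hIZ
    rcases 𝒞.eq_empty_or_nonempty with rfl | hne
    · obtain ⟨B, hB, hIB⟩ := hI.exists_isBase_superset
      exact ⟨B, ⟨hB, by simp⟩, hIB⟩
    · obtain ⟨Z, hZ, hmin⟩ := 𝒞.exists_minimal hne
      have hZle : ∀ Y ∈ 𝒞, Z ⊆ Y := fun Y hY =>
        (h𝒞.total hZ hY).elim id fun h => hmin hY h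
      obtain ⟨J, hJ, hIJ⟩ := hI.subset_isBasis_of_subset (hIZ Z hZ) (by rw [hM]; exact Z.subset_univ)
      obtain ⟨B, ⟨hB, hBZ⟩, hJB⟩ := ih (𝒞.erase Z) (Finset.erase_ssubset hZ)
        (h𝒞.mono (by simp)) J hJ.indep
        (fun Y hY => hJ.subset.trans (hZle Y (Finset.mem_of_mem_erase hY)))
      refine ⟨B, ⟨hB, fun Y hY => ?_⟩, hIJ.trans hJB⟩
      rcases eq_or_ne Y Z with rfl | hne
      · rwa [← hJ.eq_of_subset_indep (hB.indep.inter_right Y) (Set.subset_inter hJB hJ.subset)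
          Set.inter_subset_right]
      · exact hBZ Y (Finset.mem_erase.2 ⟨hne, hY⟩)

theorem faceBases_nonempty (hM : M.E = Set.univ) (h𝒞 : IsChain (· ⊆ ·) (𝒞 : Set (Set α))) :
    (M.faceBases 𝒞).Nonempty :=
  (exists_mem_faceBases_of_indep hM h𝒞 ∅ M.empty_indep (by simp)).imp fun _ h => h.1

/-- Refine the chain by `insert e Z`, with `Z` the largest member missing `e`. A base adapted to the
refined chain that avoided `e` would meet `Z` and `insert e Z` in the same set, putting `e` in the
closure of the flat `Z`. -/
theorem exists_mem_faceBases_of_notMem (hM : M.E = Set.univ)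
    (h𝒞 : IsChain (· ⊆ ·) (𝒞 : Set (Set α))) (hF : ∀ Z ∈ 𝒞, M.IsFlat Z) {e : α}
    (he : ∃ Z ∈ 𝒞, e ∉ Z) : ∃ B ∈ M.faceBases 𝒞, e ∈ B := by
  classical
  obtain ⟨Z, hZ, hmax⟩ := (𝒞.filter (e ∉ ·)).exists_maximal (by simpa [Finset.Nonempty] using he)
  simp only [Finset.mem_filter] at hZ hmax
  have hle : ∀ Y ∈ 𝒞, e ∉ Y → Y ⊆ Z := fun Y hY heY =>
    (h𝒞.total hY hZ.1).elim id fun h => hmax ⟨hY, heY⟩ h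
  have hge : ∀ Y ∈ 𝒞, e ∈ Y → insert e Z ⊆ Y := fun Y hY heY =>
    Set.insert_subset heY ((h𝒞.total hY hZ.1).elim (fun h => absurd (h heY) hZ.2) id)
  have hch : IsChain (· ⊆ ·) ((insert (insert e Z) 𝒞 : Finset (Set α)) : Set (Set α)) := by
    rw [Finset.coe_insert]
    refine h𝒞.insert fun Y hY _ => ?_
    by_cases heY : e ∈ Y
    · exact Or.inl (hge Y hY heY)
    · exact Or.inr ((hle Y hY heY).trans (Set.subset_insert e Z))
  obtain ⟨B, hB, hBZ⟩ := faceBases_nonempty hM hch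
  refine ⟨B, ⟨hB, fun Y hY => hBZ Y (Finset.mem_insert_of_mem hY)⟩, ?_⟩
  by_contra heB
  have h1 := hBZ _ (Finset.mem_insert_self _ _)
  rw [Set.inter_insert_of_notMem heB] at h1
  have h2 : e ∈ M.closure Z :=
    M.closure_subset_closure Set.inter_subset_right (h1.subset_closure (Set.mem_insert e Z))
  rw [(hF Z hZ.1).closure] at h2
  exact hZ.2 h2

/-- If `e` were in the closure of `Z` but outside `Z`, it would be spanned by `B ∩ Z` for each
adapted base `B`, so no such `B` could contain it. -/
theorem isFlat_of_exists_mem_faceBases {Z : Set α} (hM : M.E = Set.univ) (hZ : Z ∈ 𝒞)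
    (h : ∀ e ∉ Z, ∃ B ∈ M.faceBases 𝒞, e ∈ B) : M.IsFlat Z := by
  rw [isFlat_iff_closure_eq]
  refine Set.Subset.antisymm (fun e he => ?_) (M.subset_closure Z (by rw [hM]; exact Z.subset_univ))
  by_contra heZ
  obtain ⟨B, ⟨hB, hBZ⟩, heB⟩ := h e heZ
  rw [← (hBZ Z hZ).closure_eq_closure] at he
  exact hB.indep.notMem_closure_sdiff_of_mem heB
    (M.closure_subset_closure (Set.subset_sdiff_singleton Set.inter_subset_left
      fun h => heZ h.2) he)

open Classical in
theorem compl_mem_faceBases_dual (hM : M.E = Set.univ) (hB : B ∈ M.faceBases 𝒞) :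
    Bᶜ ∈ M✶.faceBases (𝒞.image compl) := by
  refine ⟨by rw [Set.compl_eq_univ_sdiff, ← hM]; exact hB.1.compl_isBase_dual, fun Y hY => ?_⟩
  obtain ⟨Z, hZ, rfl⟩ := Finset.mem_image.1 hY
  have := hB.1.compl_inter_isBasis_of_inter_isBasis (hB.2 Z hZ)
  rwa [hM, ← Set.compl_eq_univ_sdiff, ← Set.compl_eq_univ_sdiff] at this

open Classical in
theorem compl_mem_faceBases_of_dual (hM : M.E = Set.univ) (hB : B ∈ M✶.faceBases (𝒞.image compl)) :
    Bᶜ ∈ M.faceBases 𝒞 := by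
  have := compl_mem_faceBases_dual (M := M✶) hM hB
  rw [dual_dual, Finset.image_image] at this
  simpa using this

/-- The first condition encodes flatness of the members. The second is the same statement for the
dual matroid and the chain of complements, since complementation exchanges the adapted bases of the
two. -/
theorem forall_isCyclicFlat_iff (hM : M.E = Set.univ) (h𝒞 : IsChain (· ⊆ ·) (𝒞 : Set (Set α))) :
    (∀ Z ∈ 𝒞, M.IsCyclicFlat Z) ↔
      (∀ e, (∃ Z ∈ 𝒞, e ∉ Z) → ∃ B ∈ M.faceBases 𝒞, e ∈ B) ∧
      (∀ e, (∃ Z ∈ 𝒞, e ∈ Z) → ∃ B ∈ M.faceBases 𝒞, e ∉ B) := by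
  classical
  have hcyc : ∀ Z, M.IsCyclicFlat Z ↔ M.IsFlat Z ∧ M✶.IsFlat Zᶜ := fun Z => by
    rw [IsCyclicFlat, hM, Set.compl_eq_univ_sdiff]
  simp only [hcyc]
  constructor
  · intro h
    refine ⟨fun e he => exists_mem_faceBases_of_notMem hM h𝒞 (fun Z hZ => (h Z hZ).1) he, ?_⟩
    rintro e ⟨Z, hZ, heZ⟩
    have hch : IsChain (· ⊆ ·) ((𝒞.image compl : Finset (Set α)) : Set (Set α)) := by
      rw [Finset.coe_image]
      rintro _ ⟨Y, hY, rfl⟩ _ ⟨Y', hY', rfl⟩ _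
      simp only [Set.compl_subset_compl]
      exact h𝒞.total hY' hY
    obtain ⟨B, hB, heB⟩ := exists_mem_faceBases_of_notMem (M := M✶) hM hch
      (Finset.forall_mem_image.2 fun Y hY => (h Y hY).2) (e := e) ⟨Zᶜ, by simpa using hZ, by simpa using heZ⟩
    exact ⟨Bᶜ, compl_mem_faceBases_of_dual hM hB, by simpa using heB⟩
  · rintro ⟨h1, h2⟩ Z hZ
    refine ⟨isFlat_of_exists_mem_faceBases hM hZ fun e he => h1 e ⟨Z, hZ, he⟩,
      isFlat_of_exists_mem_faceBases (𝒞 := 𝒞.image compl) hM (Finset.mem_image_of_mem _ hZ) ?_⟩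
    intro e he
    obtain ⟨B, hB, heB⟩ := h2 e ⟨Z, hZ, by simpa using he⟩
    exact ⟨Bᶜ, compl_mem_faceBases_dual hM hB, heB⟩

theorem IsBasis.natRk_eq_ncard {I X : Set α} (h : M.IsBasis I X) : M.natRk X = I.ncard := by
  rw [natRk, h.eRk_eq_encard]
  rfl

end FaceBases

/-! ### Faces of the matroid polytope and the test region -/

section Polytope

variable {α : Type*} [Fintype α] {M : Matroid α} {𝒞 : Finset (Set α)} {B X : Set α}

open Classical in
/-- The sum of the coordinates in `X`, as a linear form. -/
noncomputable def coordSum (X : Set α) : (α → ℝ) →L[ℝ] ℝ :=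
  ∑ a with a ∈ X, ContinuousLinearMap.proj (R := ℝ) (φ := fun _ : α => ℝ) a

theorem coordSum_indicator (X B : Set α) :
    coordSum X (B.indicator 1) = ((B ∩ X).ncard : ℝ) := by
  classical
  simp [coordSum, Set.indicator_apply, Set.ncard_eq_toFinset_card', Finset.filter_filter,
    Set.toFinset_inter]
  congr 1
  ext a
  simp [and_comm]

theorem Indep.ncard_le_natRk {I : Set α} (h : M.Indep I) (hI : I ⊆ X) : I.ncard ≤ M.natRk X := by
  have h1 := h.encard_le_eRk_of_subset hI
  have h2 : M.eRk X ≠ ⊤ := ((M.eRk_le_encard X).trans_lt X.toFinite.encard_lt_top).ne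
  exact ENat.toNat_le_toNat h1 h2

theorem Indep.isBasis_of_ncard_eq_natRk {I : Set α} (h : M.Indep I) (hI : I ⊆ X)
    (hX : X ⊆ M.E) (hr : I.ncard = M.natRk X) : M.IsBasis I X := by
  obtain ⟨J, hJ, hIJ⟩ := h.subset_isBasis_of_subset hI hX
  rwa [Set.eq_of_subset_of_ncard_le hIJ (by rw [hr, hJ.natRk_eq_ncard]) J.toFinite]

/-- The case of `Set.univ` is allowed outside `𝒞` because all bases have the same size; it lets the
rank of `M` be prescribed too, as the corank requires. -/
theorem mem_faceBases_coordSum (hM : M.E = Set.univ) (hB : B ∈ M.faceBases 𝒞)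
    (hX : X ∈ 𝒞 ∨ X = Set.univ) : coordSum X (B.indicator 1) = M.natRk X := by
  rw [coordSum_indicator]
  rcases hX with hX | rfl
  · rw [(hB.2 X hX).natRk_eq_ncard]
  · rw [Set.inter_univ, ← hM, hB.1.isBasis_ground.natRk_eq_ncard]

/-- The linear form whose maximum over the matroid polytope is attained at `faceBases`. -/
noncomputable def chainForm (𝒞 : Finset (Set α)) : (α → ℝ) →L[ℝ] ℝ := ∑ Z ∈ 𝒞, coordSum Z

theorem chainForm_indicator_le (hB : M.IsBase B) :
    chainForm 𝒞 (B.indicator 1) ≤ ∑ Z ∈ 𝒞, (M.natRk Z : ℝ) := by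
  simp only [chainForm, _root_.sum_apply, coordSum_indicator]
  exact Finset.sum_le_sum fun Z _ => by
    exact_mod_cast (hB.indep.inter_right Z).ncard_le_natRk Set.inter_subset_right

theorem chainForm_indicator_eq_iff (hM : M.E = Set.univ) (hB : M.IsBase B) :
    chainForm 𝒞 (B.indicator 1) = ∑ Z ∈ 𝒞, (M.natRk Z : ℝ) ↔ B ∈ M.faceBases 𝒞 := by
  simp only [chainForm, _root_.sum_apply, coordSum_indicator]
  rw [Finset.sum_eq_sum_iff_of_le fun Z _ => by
    exact_mod_cast (hB.indep.inter_right Z).ncard_le_natRk Set.inter_subset_right]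
  constructor
  · exact fun h => ⟨hB, fun Z hZ => (hB.indep.inter_right Z).isBasis_of_ncard_eq_natRk
      Set.inter_subset_right (by rw [hM]; exact Z.subset_univ) (by exact_mod_cast h Z hZ)⟩
  · exact fun h Z hZ => by rw [(h.2 Z hZ).natRk_eq_ncard]

theorem isCompact_polytope (M : Matroid α) : IsCompact M.polytope := by
  refine Set.Finite.isCompact_convexHull ℝ ?_
  refine (Set.toFinite (Set.range fun B : Set α => B.indicator (1 : α → ℝ))).subset ?_
  rintro _ ⟨B, _, rfl⟩
  exact ⟨B, rfl⟩

/-- The open half-space `w < c` together with the hull of the maximizing points is already convex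
and contains `S`, hence contains the whole hull. -/
theorem mem_convexHull_of_forall_le {E : Type*} [AddCommGroup E] [Module ℝ E] {S : Set E}
    {w : E →ₗ[ℝ] ℝ} {c : ℝ} (hS : ∀ x ∈ S, w x ≤ c) {x : E} (hx : x ∈ convexHull ℝ S)
    (hxc : c ≤ w x) : x ∈ convexHull ℝ {y ∈ S | w y = c} := by
  have hface : ∀ y ∈ convexHull ℝ {y ∈ S | w y = c}, w y = c := fun y hy =>
    convexHull_min (t := {y | w y = c}) (fun z hz => hz.2) (convex_hyperplane w.isLinear c) hy
  have hconv : Convex ℝ ({y | w y < c} ∪ convexHull ℝ {y ∈ S | w y = c}) := by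
    rw [convex_iff_forall_pos]
    have hc : ∀ a b : ℝ, a + b = 1 → c = a * c + b * c := fun a b h => by
      rw [← add_mul, h, one_mul]
    rintro y (hy | hy) z (hz | hz) a b ha hb hab
    · exact Or.inl (convex_halfSpace_lt w.isLinear c hy hz ha.le hb.le hab)
    · left
      have hy' : w y < c := hy
      simp only [Set.mem_ofPred_eq, map_add, map_smul, smul_eq_mul, hface z hz]
      linarith [hc a b hab, mul_lt_mul_of_pos_left hy' ha]
    · left
      have hz' : w z < c := hz
      simp only [Set.mem_ofPred_eq, map_add, map_smul, smul_eq_mul, hface y hy]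
      linarith [hc a b hab, mul_lt_mul_of_pos_left hz' hb]
    · exact Or.inr (convex_convexHull ℝ _ hy hz ha.le hb.le hab)
  refine (convexHull_min (fun y hy => ?_) hconv hx).resolve_left fun h => absurd hxc (not_le.2 h)
  rcases (hS y hy).lt_or_eq with h | h
  · exact Or.inl h
  · exact Or.inr (subset_convexHull ℝ _ ⟨hy, h⟩)

theorem toExposed_polytope (hM : M.E = Set.univ) (h𝒞 : IsChain (· ⊆ ·) (𝒞 : Set (Set α))) :
    (chainForm 𝒞).toExposed M.polytope =
      convexHull ℝ ((fun B : Set α => B.indicator 1) '' M.faceBases 𝒞) := by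
  have hle : ∀ x ∈ M.polytope, chainForm 𝒞 x ≤ ∑ Z ∈ 𝒞, (M.natRk Z : ℝ) := fun x hx =>
    convexHull_min (t := {y | chainForm 𝒞 y ≤ ∑ Z ∈ 𝒞, (M.natRk Z : ℝ)})
      (by rintro _ ⟨B, hB, rfl⟩; exact chainForm_indicator_le hB)
      (convex_halfSpace_le (chainForm 𝒞).isLinear _) hx
  ext x
  constructor
  · rintro ⟨hx, hmax⟩
    obtain ⟨B, hB⟩ := faceBases_nonempty hM h𝒞
    have := hmax (B.indicator 1) (subset_convexHull ℝ _ ⟨B, hB.1, rfl⟩)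
    rw [(chainForm_indicator_eq_iff hM hB.1).2 hB] at this
    refine convexHull_mono ?_ (mem_convexHull_of_forall_le (w := (chainForm 𝒞 : (α → ℝ) →ₗ[ℝ] ℝ))
      (fun y hy => hle y (subset_convexHull ℝ _ hy)) hx this)
    rintro _ ⟨⟨B, hB, rfl⟩, hw⟩
    exact ⟨B, (chainForm_indicator_eq_iff hM hB).1 hw, rfl⟩
  · intro hx
    refine ⟨convexHull_mono ?_ hx, fun y hy => (hle y hy).trans_eq (Eq.symm ?_)⟩
    · rintro _ ⟨B, hB, rfl⟩
      exact ⟨B, hB.1, rfl⟩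
    · refine convexHull_min (t := {y | chainForm 𝒞 y = ∑ Z ∈ 𝒞, (M.natRk Z : ℝ)}) ?_
        (convex_hyperplane (chainForm 𝒞).isLinear _) hx
      rintro _ ⟨B, hB, rfl⟩
      exact (chainForm_indicator_eq_iff hM hB.1).2 hB

/-- The conditions that cut out of the face given by `𝒞` a nonempty set exactly if the members of
`𝒞` are cyclic flats and the pairs in `D` record ranks. -/
def cyclicRegion (𝒞 : Finset (Set α)) (D : Set (Set α × ℕ)) : Set (α → ℝ) :=
  {x | (∀ e, (∃ Z ∈ 𝒞, e ∉ Z) → (Fintype.card (Set α) : ℝ)⁻¹ ≤ x e) ∧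
    (∀ e, (∃ Z ∈ 𝒞, e ∈ Z) → x e ≤ 1 - (Fintype.card (Set α) : ℝ)⁻¹) ∧
    ∀ p ∈ D, coordSum p.1 x = p.2}

theorem isClosed_cyclicRegion (D : Set (Set α × ℕ)) : IsClosed (cyclicRegion 𝒞 D) := by
  simp only [cyclicRegion, Set.ofPred_and, Set.ofPred_forall]
  refine .inter (isClosed_iInter fun e => isClosed_iInter fun _ => ?_)
    (.inter (isClosed_iInter fun e => isClosed_iInter fun _ => ?_)
      (isClosed_iInter fun p => isClosed_iInter fun _ => ?_))
  · exact isClosed_le continuous_const (continuous_apply e)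
  · exact isClosed_le (continuous_apply e) continuous_const
  · exact isClosed_eq (coordSum p.1).continuous continuous_const

theorem convex_cyclicRegion (D : Set (Set α × ℕ)) : Convex ℝ (cyclicRegion 𝒞 D) := by
  have hproj := fun e : α => (LinearMap.proj (R := ℝ) (φ := fun _ : α => ℝ) e).isLinear
  simp only [cyclicRegion, Set.ofPred_and, Set.ofPred_forall]
  refine .inter (convex_iInter fun e => convex_iInter fun _ => ?_)
    (.inter (convex_iInter fun e => convex_iInter fun _ => ?_)
      (convex_iInter fun p => convex_iInter fun _ => ?_))
  · exact convex_halfSpace_ge (hproj e) _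
  · exact convex_halfSpace_le (hproj e) _
  · exact convex_hyperplane (coordSum p.1).isLinear _

theorem toExposed_inter_cyclicRegion_nonempty_iff (hM : M.E = Set.univ)
    (h𝒞 : IsChain (· ⊆ ·) (𝒞 : Set (Set α))) {D : Set (Set α × ℕ)}
    (hD : ∀ p ∈ D, p.1 ∈ 𝒞 ∨ p.1 = Set.univ) :
    ((chainForm 𝒞).toExposed M.polytope ∩ cyclicRegion 𝒞 D).Nonempty ↔
      (∀ Z ∈ 𝒞, M.IsCyclicFlat Z) ∧ ∀ p ∈ D, M.natRk p.1 = p.2 := by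
  classical
  rw [toExposed_polytope hM h𝒞, forall_isCyclicFlat_iff hM h𝒞]
  have hrk : ∀ x ∈ convexHull ℝ ((fun B : Set α => B.indicator (1 : α → ℝ)) '' M.faceBases 𝒞),
      ∀ p ∈ D, coordSum p.1 x = M.natRk p.1 := fun x hx p hp => by
    refine convexHull_min (t := {y | coordSum p.1 y = M.natRk p.1}) ?_
      (convex_hyperplane (coordSum p.1).isLinear _) hx
    rintro _ ⟨B, hB, rfl⟩
    exact mem_faceBases_coordSum hM hB (hD p hp)
  have hδ : (0 : ℝ) < (Fintype.card (Set α) : ℝ)⁻¹ := by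
    have : 0 < Fintype.card (Set α) := Fintype.card_pos
    positivity
  have hproj := fun e : α => (LinearMap.proj (R := ℝ) (φ := fun _ : α => ℝ) e).isLinear
  constructor
  · rintro ⟨x, hx, hx1, hx2, hx3⟩
    refine ⟨⟨fun e he => ?_, fun e he => ?_⟩, fun p hp => ?_⟩
    · by_contra! hcon
      have : x e = 0 := by
        refine convexHull_min (t := {y : α → ℝ | y e = 0}) ?_ (convex_hyperplane (hproj e) _) hx
        rintro _ ⟨B, hB, rfl⟩
        simpa using hcon B hB
      linarith [hx1 e he]
    · by_contra! hcon
      have : x e = 1 := by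
        refine convexHull_min (t := {y : α → ℝ | y e = 1}) ?_ (convex_hyperplane (hproj e) _) hx
        rintro _ ⟨B, hB, rfl⟩
        exact Set.indicator_of_mem (hcon B hB) _
      linarith [hx2 e he]
    · have := (hrk x hx p hp).symm.trans (hx3 p hp)
      exact_mod_cast this
  · rintro ⟨⟨h1, h2⟩, h3⟩
    set 𝓑 : Finset (Set α) := (M.faceBases 𝒞).toFinset
    have h𝓑 : 0 < 𝓑.card := by
      rw [Finset.card_pos, Set.toFinset_nonempty]
      exact faceBases_nonempty hM h𝒞
    have hpos : (0 : ℝ) < 𝓑.card := by exact_mod_cast h𝓑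
    -- The margin in `cyclicRegion` must not depend on `M`. The number of all subsets bounds the
    -- number of adapted bases, so its inverse is at most the weight of each vertex in the
    -- barycentre.
    have hcard : (Fintype.card (Set α) : ℝ)⁻¹ ≤ (𝓑.card : ℝ)⁻¹ := by
      apply inv_anti₀ hpos
      exact_mod_cast Finset.card_le_univ 𝓑
    -- The barycentre of the vertices of the face: one base containing `e` keeps its `e`-coordinate
    -- away from 0, and one base avoiding `e` keeps it away from 1.
    set x : α → ℝ := ∑ B ∈ 𝓑, (𝓑.card : ℝ)⁻¹ • B.indicator (1 : α → ℝ)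
    have hx : x ∈ convexHull ℝ
        ((fun B : Set α => B.indicator (1 : α → ℝ)) '' M.faceBases 𝒞) := by
      refine (convex_convexHull ℝ _).sum_mem (fun _ _ => by positivity) ?_ fun B hB =>
        subset_convexHull ℝ _ ⟨B, by simpa [𝓑] using hB, rfl⟩
      rw [Finset.sum_const, nsmul_eq_mul, mul_inv_cancel₀ hpos.ne']
    have hxe : ∀ e, x e = ∑ B ∈ 𝓑, (𝓑.card : ℝ)⁻¹ * B.indicator (1 : α → ℝ) e := fun e => by
      simp [x, Finset.sum_apply]
    refine ⟨x, hx, fun e he => ?_, fun e he => ?_, fun p hp => ?_⟩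
    · obtain ⟨B, hB, heB⟩ := h1 e he
      refine hcard.trans ?_
      rw [hxe]
      refine le_trans (by simp [heB]) (Finset.single_le_sum (a := B) (fun B' _ => ?_)
        (by simpa [𝓑] using hB))
      exact mul_nonneg (by positivity) (Set.indicator_nonneg (by simp) _)
    · obtain ⟨B, hB, heB⟩ := h2 e he
      have hsum : 1 - x e = ∑ B ∈ 𝓑, (𝓑.card : ℝ)⁻¹ * (1 - B.indicator (1 : α → ℝ) e) := by
        simp only [mul_sub, Finset.sum_sub_distrib, hxe, mul_one, Finset.sum_const, nsmul_eq_mul,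
          mul_inv_cancel₀ hpos.ne']
      have : (𝓑.card : ℝ)⁻¹ ≤ 1 - x e := by
        rw [hsum]
        refine le_trans (by simp [heB]) (Finset.single_le_sum (a := B) (fun B' _ => ?_)
          (by simpa [𝓑] using hB))
        refine mul_nonneg (by positivity) (sub_nonneg.2 ?_)
        exact Set.indicator_le_self' (f := (1 : α → ℝ)) (fun _ _ => zero_le_one) e
      linarith
    · rw [hrk x hx p hp, h3 p hp]

end Polytope

end Matroid
namespace Matroid
-- Valuations from chains, the Möbius function and `τ`
section Valuation

variable {α G : Type*} [AddCommGroup G]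

theorem IsValuation.congr {f g : Matroid α → G} (hf : IsValuation f)
    (h : ∀ M : Matroid α, M.E = Set.univ → g M = f M) : IsValuation g := by
  intro k M c hM hc
  rw [← hf k M c hM hc]
  exact Finset.sum_congr rfl fun i _ => by rw [h _ (hM i)]

theorem IsValuation.sum {ι : Type*} (s : Finset ι) {f : ι → Matroid α → G}
    (hf : ∀ j ∈ s, IsValuation (f j)) : IsValuation fun M => ∑ j ∈ s, f j M := by
  intro k M c hM hc
  simp only [Finset.smul_sum]
  rw [Finset.sum_comm]
  exact Finset.sum_eq_zero fun j hj => hf j hj k M c hM hc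

theorem IsValuation.zsmul {f : Matroid α → G} (hf : IsValuation f) (m : ℤ) :
    IsValuation fun M => m • f M := by
  intro k M c hM hc
  simp only [smul_comm _ m]
  rw [← Finset.smul_sum, hf k M c hM hc, smul_zero]

open Classical in
/-- Whether the members of a chain `𝒞` are cyclic flats, together with prescribed ranks of some of
them and of the matroid, is a valuation. -/
theorem isValuation_chain [Fintype α] {𝒞 : Finset (Set α)}
    (h𝒞 : IsChain (· ⊆ ·) (𝒞 : Set (Set α))) {D : Set (Set α × ℕ)}
    (hD : ∀ p ∈ D, p.1 ∈ 𝒞 ∨ p.1 = Set.univ) :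
    IsValuation fun M : Matroid α =>
      if (∀ Z ∈ 𝒞, M.IsCyclicFlat Z) ∧ ∀ p ∈ D, M.natRk p.1 = p.2 then (1 : ℤ) else 0 := by
  intro k M c hM hc
  have hK : ∀ i, IsCompact (M i).polytope := fun i => isCompact_polytope _
  have hKc : ∀ i, Convex ℝ (M i).polytope := fun i => convex_convexHull ℝ _
  have hrel : ∀ x, ∑ i, (if x ∈ (M i).polytope then c i else 0) = 0 := by
    intro x
    refine Eq.trans ?_ (congrFun hc x)
    simp [Finset.sum_apply, Set.indicator_apply]
  have hexp := fun i => ContinuousLinearMap.toExposed.isExposed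
    (l := chainForm 𝒞) (A := (M i).polytope)
  have := sum_inter_nonempty_eq_zero c (fun i => (chainForm 𝒞).toExposed (M i).polytope)
    (fun i => (hexp i).isCompact (hK i)) (fun i => (hexp i).convex (hKc i))
    (sum_mem_toExposed_eq_zero c _ hK hKc hrel _)
    (isClosed_cyclicRegion (𝒞 := 𝒞) D) (convex_cyclicRegion D)
  refine Eq.trans (Finset.sum_congr rfl fun i _ => ?_) this
  rw [if_congr (toExposed_inter_cyclicRegion_nonempty_iff (hM i) h𝒞 hD) rfl rfl, smul_eq_mul,
    mul_ite, mul_one, mul_zero]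

theorem isValuation_cyclicFlatIndicator [Fintype α] {k : ℕ} {X : Fin k → Set α} (hX : Monotone X)
    (r : Fin k → ℕ) : IsValuation (cyclicFlatIndicator X r) := by
  classical
  refine (isValuation_chain (𝒞 := Finset.univ.image X) (D := Set.range fun i => (X i, r i))
    ?_ (by simp)).congr fun M _ => ?_
  · rw [Finset.coe_image, Finset.coe_univ, Set.image_univ]
    exact hX.isChain_range
  · rw [cyclicFlatIndicator]
    refine if_congr ?_ rfl rfl
    simp [forall_and]

open Classical in
/-- The Möbius function of the cyclic flats of `M`, extended by zero to all pairs of sets. -/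
noncomputable def cyclicFlatMu [Finite α] (M : Matroid α) (A B : Set α) : ℤ :=
  if h : M.IsCyclicFlat A ∧ M.IsCyclicFlat B then
    IncidenceAlgebra.mu ℤ (⟨A, h.1⟩ : M.CyclicFlat) ⟨B, h.2⟩ else 0

theorem cyclicFlatMu_self [Finite α] {M : Matroid α} {A : Set α} (hA : M.IsCyclicFlat A) :
    M.cyclicFlatMu A A = 1 := by
  simp [cyclicFlatMu, hA]

open Classical in
theorem cyclicFlatMu_empty [Fintype α] {M : Matroid α} {F : Set α} (h0 : M.IsCyclicFlat ∅)
    (hF : M.IsCyclicFlat F) (hne : F ≠ ∅) :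
    M.cyclicFlatMu ∅ F = -∑ A : Set α with A ⊂ F, M.cyclicFlatMu ∅ A := by
  rw [cyclicFlatMu, dif_pos ⟨h0, hF⟩, IncidenceAlgebra.mu_eq_neg_sum_Ico_of_ne
    (fun h => hne (congrArg Subtype.val h).symm)]
  congr 1
  symm
  refine Finset.sum_bij_ne_zero (fun A _ hA => ⟨A, by
      by_contra hcon
      exact hA (dif_neg fun h => hcon h.2)⟩) ?_ ?_ ?_ ?_
  · intro A hA _
    rw [Finset.mem_Ico]
    exact ⟨Set.empty_subset A, by simpa [← Subtype.coe_lt_coe] using hA⟩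
  · intro A _ _ A' _ _ h
    exact congrArg Subtype.val h
  · intro A hA hA0
    refine ⟨A.1, ?_, ?_, rfl⟩
    · have := (Finset.mem_Ico.1 hA).2
      simpa [← Subtype.coe_lt_coe] using this
    · rwa [cyclicFlatMu, dif_pos ⟨h0, A.2⟩]
  · intro A _ hA
    have hA' : M.IsCyclicFlat A := by
      by_contra hcon
      exact hA (dif_neg fun h => hcon h.2)
    rw [cyclicFlatMu, dif_pos ⟨h0, hA'⟩]

-- Induction on the size of `F` through the recursion `cyclicFlatMu_empty`. Each `A ⊂ F` is added to
-- `𝒞`, and since every nonempty member contains `F`, the result is still a chain, now with `A` in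
-- the role of `F`. The old members stay in `𝒞` so that the cyclic flat and rank conditions are
-- retained.
open Classical in
theorem isValuation_cyclicFlatMu [Fintype α] (F : Set α) {𝒞 : Finset (Set α)}
    (h𝒞 : IsChain (· ⊆ ·) (𝒞 : Set (Set α))) {D : Set (Set α × ℕ)}
    (hD : ∀ p ∈ D, p.1 ∈ 𝒞 ∨ p.1 = Set.univ) (h0 : ∅ ∈ 𝒞) (hF : F ∈ 𝒞)
    (hF' : ∀ Z ∈ 𝒞, Z = ∅ ∨ F ⊆ Z) :
    IsValuation fun M : Matroid α =>
      if (∀ Z ∈ 𝒞, M.IsCyclicFlat Z) ∧ ∀ p ∈ D, M.natRk p.1 = p.2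
        then M.cyclicFlatMu ∅ F else 0 := by
  induction F using (measure Set.ncard).wf.induction generalizing 𝒞 with
  | _ F ih =>
    rcases eq_or_ne F ∅ with rfl | hne
    · refine (isValuation_chain h𝒞 hD).congr fun M _ => ?_
      split_ifs with h
      · exact cyclicFlatMu_self (h.1 ∅ h0)
      · rfl
    · have hval : IsValuation fun M : Matroid α => (-1 : ℤ) • ∑ A : Set α with A ⊂ F,
          if (∀ Z ∈ insert A 𝒞, M.IsCyclicFlat Z) ∧ ∀ p ∈ D, M.natRk p.1 = p.2
            then M.cyclicFlatMu ∅ A else 0 := by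
        refine (IsValuation.sum _ fun A hA => ?_).zsmul _
        have hAF : A ⊂ F := by simpa using hA
        refine ih A (Set.ncard_lt_ncard hAF F.toFinite) ?_ ?_ ?_ ?_ ?_
        · rw [Finset.coe_insert]
          refine h𝒞.insert fun Z hZ _ => ?_
          rcases hF' Z hZ with rfl | h
          · exact Or.inr (Set.empty_subset A)
          · exact Or.inl (hAF.subset.trans h)
        · exact fun p hp => (hD p hp).imp_left Finset.mem_insert_of_mem
        · exact Finset.mem_insert_of_mem h0
        · exact Finset.mem_insert_self _ _
        · intro Z hZ
          rcases Finset.mem_insert.1 hZ with rfl | hZ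
          · exact Or.inr subset_rfl
          · exact (hF' Z hZ).imp_right hAF.subset.trans
      refine hval.congr fun M _ => ?_
      split_ifs with h
      · rw [cyclicFlatMu_empty (h.1 ∅ h0) (h.1 F hF) hne, neg_one_smul]
        congr 1
        refine Finset.sum_congr rfl fun A _ => ?_
        by_cases hA : M.IsCyclicFlat A
        · rw [if_pos ⟨by simpa [hA] using h.1, h.2⟩]
        -- Sets `A` that are not cyclic flats contribute nothing, thanks to the extension of `μ` by
        -- zero.
        · rw [cyclicFlatMu, dif_neg fun h => hA h.2, ite_self]
      · rw [Finset.sum_eq_zero, smul_zero]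
        intro A _
        exact if_neg fun h' => h ⟨fun Z hZ => h'.1 Z (Finset.mem_insert_of_mem hZ), h'.2⟩

theorem natRk_le_card [Fintype α] (M : Matroid α) (X : Set α) :
    M.natRk X ≤ Fintype.card α := by
  have h := M.eRk_le_encard X
  refine (ENat.toNat_le_toNat h X.toFinite.encard_lt_top.ne).trans ?_
  rw [← Set.ncard, ← Nat.card_eq_fintype_card]
  exact Set.ncard_le_card X

open Classical in
theorem tau_empty_eq [Fintype α] {M : Matroid α} (h0 : M.IsCyclicFlat ∅) :
    M.tau ∅ = ∑ F : Set α, M.cyclicFlatMu ∅ F * M.corank F := by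
  rw [tau, dif_pos h0]
  symm
  refine Finset.sum_bij_ne_zero (fun F _ hF => ⟨F, by
      by_contra hcon
      exact hF (by rw [cyclicFlatMu, dif_neg fun h => hcon h.2, zero_mul])⟩) ?_ ?_ ?_ ?_
  · intro F _ _
    simp
  · intro A _ _ A' _ _ h
    exact congrArg Subtype.val h
  · intro F _ hF
    have hF' : M.cyclicFlatMu ∅ F = IncidenceAlgebra.mu ℤ ⟨∅, h0⟩ F := by
      rw [cyclicFlatMu, dif_pos ⟨h0, F.2⟩]
    exact ⟨F.1, Finset.mem_univ _, by rwa [hF'], rfl⟩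
  · intro F _ hF
    have hF' : M.IsCyclicFlat F := by
      by_contra hcon
      exact hF (by rw [cyclicFlatMu, dif_neg fun h => hcon h.2, zero_mul])
    exact congrArg (· * M.corank F) (dif_pos ⟨h0, hF'⟩)

theorem isValuation_tau_empty [Fintype α] : IsValuation fun M : Matroid α => M.tau ∅ := by
  classical
  -- The corank varies with `M`, so it cannot simply be pulled out as a coefficient. Fixing the pair
  -- `q` of the rank of `M` and the rank of `F`, both at most the size of `α`, makes it the constant
  -- `q.1 - q.2`; for a given `M` exactly one pair survives.
  have hval : IsValuation fun M : Matroid α => ∑ F : Set α,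
      ∑ q ∈ Finset.range (Fintype.card α + 1) ×ˢ Finset.range (Fintype.card α + 1),
        ((q.1 : ℤ) - q.2) • if (∀ Z ∈ ({∅, F} : Finset (Set α)), M.IsCyclicFlat Z) ∧
          ∀ p ∈ ({(Set.univ, q.1), (F, q.2)} : Set (Set α × ℕ)), M.natRk p.1 = p.2
            then M.cyclicFlatMu ∅ F else 0 := by
    refine IsValuation.sum _ fun F _ => IsValuation.sum _ fun q _ => IsValuation.zsmul ?_ _
    refine isValuation_cyclicFlatMu F ?_ ?_ ?_ ?_ ?_
    · rw [Finset.coe_pair]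
      rintro Y (rfl | rfl) Z (rfl | rfl) _
      all_goals simp
    · simp
    · simp
    · simp
    · simp
  refine hval.congr fun M hM => ?_
  by_cases h0 : M.IsCyclicFlat ∅
  swap
  · rw [tau, dif_neg h0]
    simp [h0]
  rw [tau_empty_eq h0]
  refine Finset.sum_congr rfl fun F _ => ?_
  by_cases hF : M.IsCyclicFlat F
  swap
  · simp [hF, cyclicFlatMu]
  rw [Finset.sum_eq_single (M.natRk Set.univ, M.natRk F)]
  · simp [h0, hF, corank, hM, mul_comm]
  · rintro ⟨a, b⟩ _ hab
    rw [if_neg, smul_zero]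
    rintro ⟨_, h⟩
    simp only [Set.mem_insert_iff, Set.mem_singleton_iff, forall_eq_or_imp, forall_eq] at h
    exact hab (by rw [h.1, h.2])
  · intro h
    simp only [Finset.mem_product, Finset.mem_range, Nat.lt_succ_iff, natRk_le_card] at h
    simp at h

end Valuation
end Matroid

theorem lemma5p2 (n : ℕ) :
    (∀ (k : ℕ) (X : Fin (k + 1) → Set (Fin n)) (r : Fin (k + 1) → ℕ), Monotone X → Monotone r →
      Matroid.IsValuation (Matroid.cyclicFlatIndicator X r)) ∧
    Matroid.IsValuation (fun M : Matroid (Fin n) => M.tau ∅) :=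
  ⟨fun _ _ r hX _ => Matroid.isValuation_cyclicFlatIndicator hX r, Matroid.isValuation_tau_empty⟩
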